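/- Let $n\ge 0$ and $d\ge 1$ be integers, let $\mathcal H^d$ be the $d$-dimensional Hausdorff measure on $\mathbb R^n$, and write $B(0,r)$ and $\overline B(0,r)$ for the open and closed Euclidean balls. Let $U\subset\mathbb R^n$ be an open set containing $0$, and let $L_0=U$ and $L_1,\dots,L_{j_{\max}}\subset U$ be sets satisfying the following Lipschitz assumption: there are $s>0$ and a bilipschitz map $\psi$ from $sU$ onto $B(0,1)$ such that each $\psi(sL_j)$ coincides in $B(0,1)$ with a finite union of closed dyadic cubes, all of dimension $<d$ when $j\ge 1$. (A dyadic cube of dimension $k$ is a product of intervals $[m_i2^{-p},(m_i+1)2^{-p}]$ in $k$ of the coordinates and of singletons $\{m_i2^{-p}\}$ in the others, with $p,m_i\in\mathbb Z$.) Put $L'=\bigcup_{1\le j\le j_{\max}}L_j$ and assume that for some $\rho>0$ with $\overline B(0,\rho)\subset U$ the truncated cone $$\overline B(0,\rho)\cap\{\lambda z : z\in L'\cap\overline B(0,\rho),\ \lambda\ge 0\}$$ has finite $\mathcal H^d$-measure. Let $R_1>0$ be such that $B(0,R_1)\subset U$. For $0<r<R_1$ set $$L^\sharp(r)=\{\lambda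 z : z\in L'\cap\overline B(0,r),\ \lambda\in[0,1]\},\qquad m(r)=\mathcal H^d(L^\sharp(r)),\qquad H(r)=d\,r^d\int_0^r\frac{m(t)}{t^{d+1}}\,dt\in[0,\infty],$$ and let $$S=\{x\in\mathbb R^n : \lambda x\in L'\text{ for some }\lambda\in(0,1]\}$$ be the shade of $L'$ seen from the origin. Suppose that for some $R\in(0,R_1)$ the set $L'\cap B(0,R)$ meets each radius $(0,x]=\{\lambda x:\lambda\in(0,1]\}$, $x\in\mathbb R^n$, at most once. Then $$H(r)=\mathcal H^d(S\cap B(0,r))\qquad\text{for all } 0<r<R.$$ Consequently, for every set $E\subset\mathbb R^n$ and all $0<r<R$, the general functional equals the shade functional: $$r^{-d}\big[\mathcal H^d(E\cap B(0,r))+H(r)\big]=r^{-d}\big[\mathcal H^d(E\cap B(0,r))+\mathcal H^d(S\cap B(0,r))\big].$$ -/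

import Mathlib

open Set MeasureTheory Metric
open scoped Pointwise ENNReal

namespace SlidingMonotonicity

/-- The `d`-dimensional Hausdorff measure on `ℝⁿ`. -/
noncomputable abbrev hausdorff (n d : ℕ) : Measure (EuclideanSpace ℝ (Fin n)) :=
  Measure.hausdorffMeasure (d : ℝ)

/-- A dyadic cube of `ℝⁿ`, of any dimension between `0` and `n`: side length `2 ^ (-scale)`, least
vertex `2 ^ (-scale) • corner`, and sides parallel to the axes indexed by `dirs`. -/
structure DyadicCube (n : ℕ) where
  scale : ℤ
  corner : Fin n → ℤ
  dirs : Finset (Fin n)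

/-- The closed set of points of a dyadic cube: the coordinate `i` ranges over
`[k 2^(-p), (k+1) 2^(-p)]` if `i ∈ dirs`, and is equal to `k 2^(-p)` otherwise
(`k = corner i`, `p = scale`). -/
def DyadicCube.carrier {n : ℕ} (Q : DyadicCube n) : Set (EuclideanSpace ℝ (Fin n)) :=
  {x | ∀ i, (i ∈ Q.dirs →
        x i ∈ Icc ((Q.corner i : ℝ) * (2 : ℝ) ^ (-Q.scale))
          (((Q.corner i : ℝ) + 1) * (2 : ℝ) ^ (-Q.scale))) ∧
      (i ∉ Q.dirs → x i = (Q.corner i : ℝ) * (2 : ℝ) ^ (-Q.scale))}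

/-- The dimension of a dyadic cube. -/
def DyadicCube.dim {n : ℕ} (Q : DyadicCube n) : ℕ := Q.dirs.card

/-- `ψ` is a bilipschitz map of `A` onto `B`. -/
def IsBilipschitzOnto {n : ℕ} (ψ : EuclideanSpace ℝ (Fin n) → EuclideanSpace ℝ (Fin n))
    (A B : Set (EuclideanSpace ℝ (Fin n))) : Prop :=
  (∃ C : ℝ, 1 ≤ C ∧ ∀ x ∈ A, ∀ y ∈ A,
    C⁻¹ * dist x y ≤ dist (ψ x) (ψ y) ∧ dist (ψ x) (ψ y) ≤ C * dist x y) ∧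
  ψ '' A = B

/-- The boundary sets `L 0, …, L jmax` satisfy the Lipschitz assumption in `U`, with `L 0 = U` and
all the other ones made of cubes of dimension `< d`: after a dilation by some `s > 0` and a
bilipschitz map `ψ` of `s U` onto the unit ball `B(0,1)`, each `L j` coincides in `B(0,1)` with a
finite union of closed dyadic cubes, which are of dimensions `< d` when `j ≠ 0`. -/
def LipschitzAssumption {n jmax : ℕ} (d : ℕ) (U : Set (EuclideanSpace ℝ (Fin n)))
    (L : Fin (jmax + 1) → Set (EuclideanSpace ℝ (Fin n))) : Prop :=
  L 0 = U ∧ (∀ j, L j ⊆ U) ∧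
  ∃ s : ℝ, 0 < s ∧ ∃ ψ : EuclideanSpace ℝ (Fin n) → EuclideanSpace ℝ (Fin n),
    IsBilipschitzOnto ψ (s • U) (ball 0 1) ∧
    ∀ j, ∃ 𝒬 : Set (DyadicCube n), 𝒬.Finite ∧ (j ≠ 0 → ∀ Q ∈ 𝒬, Q.dim < d) ∧
      ψ '' (s • L j) = ball 0 1 ∩ ⋃ Q ∈ 𝒬, Q.carrier

/-- `L'`, the union of the boundary sets `L j`, `1 ≤ j ≤ jmax`. -/
def boundaryUnion {n jmax : ℕ} (L : Fin (jmax + 1) → Set (EuclideanSpace ℝ (Fin n))) :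
    Set (EuclideanSpace ℝ (Fin n)) :=
  ⋃ j ∈ {j : Fin (jmax + 1) | j ≠ 0}, L j

/-- The truncated cone `L*(r)` in `closedBall 0 r`, over the part of `L'` in `closedBall 0 r`. -/
def truncatedCone {n : ℕ} (L' : Set (EuclideanSpace ℝ (Fin n))) (r : ℝ) :
    Set (EuclideanSpace ℝ (Fin n)) :=
  closedBall 0 r ∩ {x | ∃ z ∈ L' ∩ closedBall 0 r, ∃ l : ℝ, 0 ≤ l ∧ x = l • z}

/-- The set `L♯(r)`, the union of the segments `[0,z]`, `z ∈ L'`, `|z| ≤ r`. -/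
def sharpSet {n : ℕ} (L' : Set (EuclideanSpace ℝ (Fin n))) (r : ℝ) :
    Set (EuclideanSpace ℝ (Fin n)) :=
  {x | ∃ z ∈ L' ∩ closedBall 0 r, ∃ l ∈ Icc (0 : ℝ) 1, x = l • z}

/-- `m(r)`, the `d`-dimensional measure of `L♯(r)`. -/
noncomputable def sharpMeasure {n : ℕ} (d : ℕ) (L' : Set (EuclideanSpace ℝ (Fin n))) (r : ℝ) :
    ℝ≥0∞ :=
  hausdorff n d (sharpSet L' r)

/-- The correction term `H(r) = d r^d ∫₀^r m(t) t^(-d-1) dt`, with values in `[0,∞]`. -/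
noncomputable def correction {n : ℕ} (d : ℕ) (L' : Set (EuclideanSpace ℝ (Fin n))) (r : ℝ) :
    ℝ≥0∞ :=
  (d : ℝ≥0∞) * ENNReal.ofReal (r ^ d) *
    ∫⁻ t in Ioo (0 : ℝ) r, sharpMeasure d L' t / ENNReal.ofReal (t ^ (d + 1))

/-- The shade of `L'`, seen from the origin. -/
def shade {n : ℕ} (L' : Set (EuclideanSpace ℝ (Fin n))) : Set (EuclideanSpace ℝ (Fin n)) :=
  {x | ∃ l ∈ Ioc (0 : ℝ) 1, l • x ∈ L'}

/-- The radius `(0,x]`. -/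
def radius {n : ℕ} (x : EuclideanSpace ℝ (Fin n)) : Set (EuclideanSpace ℝ (Fin n)) :=
  {y | ∃ l ∈ Ioc (0 : ℝ) 1, y = l • x}

/-- The general functional `F(r) = r^(-d) [H^d(E ∩ B(0,r)) + H(r)]`. -/
noncomputable def generalFunctional {n : ℕ} (d : ℕ) (L' E : Set (EuclideanSpace ℝ (Fin n)))
    (r : ℝ) : ℝ≥0∞ :=
  (hausdorff n d (E ∩ ball 0 r) + correction d L' r) / ENNReal.ofReal (r ^ d)

/-- The shade functional `F(r) = r^(-d) [H^d(E ∩ B(0,r)) + H^d(S ∩ B(0,r))]`. -/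
noncomputable def shadeFunctional {n : ℕ} (d : ℕ) (L' E : Set (EuclideanSpace ℝ (Fin n)))
    (r : ℝ) : ℝ≥0∞ :=
  (hausdorff n d (E ∩ ball 0 r) + hausdorff n d (shade L' ∩ ball 0 r)) / ENNReal.ofReal (r ^ d)

end SlidingMonotonicity

/-! Fix `r < R` and put `K = L' ∩ closedBall 0 r`, which is compact and meets each open half line
from the origin at most once. On the cone over `K`, use the coordinates `a = rayNorm K x`, constant
along rays, and `s = ‖x‖ ^ d`. A dilation by `c` fixes `a`, multiplies `s` by `c ^ d`, and
multiplies `H^d` by the same factor, so the image of `H^d` on the cone is a product `ν ⊗ ds` on `s >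
0` (`map_coneMeasure_eq_prod`). No rectifiability or coarea formula is needed.

Both sides then become integrals against `ν`. Over a given `a`, the set `L♯(t)` is `0 < s ≤ a^d` if
`a ≤ t` and empty otherwise, so `m(t) = ∫_{a ≤ t} a^d dν`; the shade is `a^d ≤ s < r^d`, with
measure `∫ (r^d - a^d)⁺ dν`. Tonelli and `d r^d a^d ∫_a^r t^(-d-1) dt = r^d - a^d` for `a < r`
finish the proof.

Tonelli and uniqueness of the product need `ν` σ-finite. This follows from finiteness of `H^d` on
bounded pieces of the cone, which are Lipschitz images of bounded sets of dimension at most `d`. -/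

namespace SlidingMonotonicity

/-! ### Cones and the distance along rays -/

section Rays

variable {E : Type*} [NormedAddCommGroup E] [NormedSpace ℝ E]

/-- The open cone over `K`, without its vertex. -/
def openCone (K : Set E) : Set E := {x | x ≠ 0 ∧ ∃ l : ℝ, 0 < l ∧ l • x ∈ K}

/-- The distance to the origin of the point of `K` on the ray through `x`, when it is unique. -/
noncomputable def rayNorm (K : Set E) (x : E) : ℝ :=
  sInf {t | ∃ l : ℝ, 0 < l ∧ l • x ∈ K ∧ t = ‖l • x‖}

/-- Each open half line issued from the origin meets `K` at most once. -/
def MeetsRaysOnce (K : Set E) : Prop :=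
  ∀ x : E, x ≠ 0 → ∀ l l' : ℝ, 0 < l → 0 < l' → l • x ∈ K → l' • x ∈ K → l = l'

/-- The union of the segments `[0, c z]`, `z ∈ K`. -/
def segmentCone (K : Set E) (c : ℝ) : Set E := {x | ∃ z ∈ K, ∃ l ∈ Icc (0 : ℝ) c, x = l • z}

theorem MeetsRaysOnce.rayNorm_eq {K : Set E} (hK : MeetsRaysOnce K) {x : E} (hx : x ≠ 0) {l : ℝ}
    (hl : 0 < l) (hlx : l • x ∈ K) : rayNorm K x = ‖l • x‖ := by
  have : {t | ∃ l : ℝ, 0 < l ∧ l • x ∈ K ∧ t = ‖l • x‖} = {‖l • x‖} := by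
    ext t
    constructor
    · rintro ⟨l', hl', h, rfl⟩
      rw [hK x hx l' l hl' hl h hlx]
      rfl
    · rintro rfl
      exact ⟨l, hl, hlx, rfl⟩
  rw [rayNorm, this, csInf_singleton]

/-- The infimum is over `∅` or, at the origin, over a subset of `{0}`; this default puts the
complement of the cone in every sublevel set with `t ≥ 0`. -/
theorem rayNorm_eq_zero {K : Set E} {x : E} (hx : x ∉ openCone K) : rayNorm K x = 0 := by
  by_cases h0 : x = 0
  · subst h0
    have : {t : ℝ | ∃ l : ℝ, 0 < l ∧ l • (0 : E) ∈ K ∧ t = ‖l • (0 : E)‖} ⊆ {0} := by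
      rintro t ⟨l, -, -, rfl⟩
      simp
    rcases subset_singleton_iff_eq.1 this with h | h <;> rw [rayNorm, h] <;> simp
  · have : {t : ℝ | ∃ l : ℝ, 0 < l ∧ l • x ∈ K ∧ t = ‖l • x‖} = ∅ := by
      refine eq_empty_of_forall_notMem ?_
      rintro t ⟨l, hl, hlx, -⟩
      exact hx ⟨h0, l, hl, hlx⟩
    rw [rayNorm, this, Real.sInf_empty]

theorem rayNorm_smul (K : Set E) (x : E) {c : ℝ} (hc : 0 < c) :
    rayNorm K (c • x) = rayNorm K x := by
  unfold rayNorm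
  congr 1
  ext t
  constructor
  · rintro ⟨l, hl, h, rfl⟩
    exact ⟨l * c, mul_pos hl hc, by rwa [mul_smul], by rw [mul_smul]⟩
  · rintro ⟨l, hl, h, rfl⟩
    have : (l / c) • c • x = l • x := by rw [smul_smul, div_mul_cancel₀ _ hc.ne']
    exact ⟨l / c, div_pos hl hc, by rwa [this], by rw [this]⟩

theorem smul_mem_openCone_iff (K : Set E) (x : E) {c : ℝ} (hc : 0 < c) :
    c • x ∈ openCone K ↔ x ∈ openCone K := by
  constructor
  · rintro ⟨h0, l, hl, h⟩
    exact ⟨fun hx => h0 (by simp [hx]), l * c, mul_pos hl hc, by rwa [mul_smul]⟩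
  · rintro ⟨h0, l, hl, h⟩
    exact ⟨smul_ne_zero hc.ne' h0, l / c, div_pos hl hc,
      by rwa [smul_smul, div_mul_cancel₀ _ hc.ne']⟩

theorem rayNorm_pos {K : Set E} (hK : MeetsRaysOnce K) {x : E} (hx : x ∈ openCone K) :
    0 < rayNorm K x := by
  obtain ⟨h0, l, hl, h⟩ := hx
  rw [hK.rayNorm_eq h0 hl h]
  exact norm_pos_iff.2 (smul_ne_zero hl.ne' h0)

theorem rayNorm_nonneg {K : Set E} (hK : MeetsRaysOnce K) (x : E) : 0 ≤ rayNorm K x := by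
  by_cases hx : x ∈ openCone K
  · exact (rayNorm_pos hK hx).le
  · exact (rayNorm_eq_zero hx).ge

theorem mem_openCone_inter_closedBall_iff {K : Set E} (hK : MeetsRaysOnce K) {x : E} {t : ℝ} :
    x ∈ openCone (K ∩ closedBall 0 t) ↔ x ∈ openCone K ∧ rayNorm K x ≤ t := by
  constructor
  · rintro ⟨h0, l, hl, h, ht⟩
    refine ⟨⟨h0, l, hl, h⟩, ?_⟩
    rw [hK.rayNorm_eq h0 hl h]
    simpa using ht
  · rintro ⟨⟨h0, l, hl, h⟩, ht⟩
    refine ⟨h0, l, hl, h, ?_⟩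
    rw [hK.rayNorm_eq h0 hl h] at ht
    simpa using ht

/-- Dilation factors confined to compact intervals of `(0,∞)` exhibit the cone over a compact set as
σ-compact minus a point, hence Borel. -/
theorem openCone_eq_iUnion (K : Set E) :
    openCone K =
      (⋃ k : ℕ, (fun p : ℝ × E => p.1 • p.2) '' (Icc ((k : ℝ) + 1)⁻¹ (k + 1) ×ˢ K)) \ {0} := by
  ext x
  constructor
  · rintro ⟨h0, l, hl, h⟩
    refine ⟨?_, h0⟩
    obtain ⟨k, hk⟩ := exists_nat_ge (max l l⁻¹)
    refine mem_iUnion.2 ⟨k, (l⁻¹, l • x), ⟨⟨?_, ?_⟩, h⟩, ?_⟩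
    · exact inv_anti₀ hl (by linarith [le_max_left l l⁻¹])
    · exact (by linarith [le_max_right l l⁻¹] : l⁻¹ ≤ (k : ℝ) + 1)
    · exact inv_smul_smul₀ hl.ne' x
  · rintro ⟨hx, h0⟩
    obtain ⟨k, ⟨l, z⟩, ⟨⟨h1, -⟩, hz⟩, rfl⟩ := mem_iUnion.1 hx
    have hl : 0 < l := lt_of_lt_of_le (by positivity) h1
    exact ⟨h0, l⁻¹, inv_pos.2 hl, by simpa [inv_smul_smul₀ hl.ne'] using hz⟩

variable [MeasurableSpace E] [BorelSpace E]

theorem measurableSet_openCone {K : Set E} (hK : IsCompact K) : MeasurableSet (openCone K) := by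
  rw [openCone_eq_iUnion]
  refine (MeasurableSet.iUnion fun k => ?_).diff (measurableSet_singleton 0)
  exact ((isCompact_Icc.prod hK).image (by fun_prop)).isClosed.measurableSet

theorem measurable_rayNorm {K : Set E} (hc : IsCompact K) (hK : MeetsRaysOnce K) :
    Measurable (rayNorm K) := by
  refine measurable_of_Iic fun t => ?_
  by_cases ht : 0 ≤ t
  · have : rayNorm K ⁻¹' Iic t = openCone (K ∩ closedBall 0 t) ∪ (openCone K)ᶜ := by
      ext x
      rw [mem_union, mem_openCone_inter_closedBall_iff hK, mem_preimage, mem_Iic, mem_compl_iff]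
      by_cases hx : x ∈ openCone K
      · simp [hx]
      · simp [hx, rayNorm_eq_zero hx, ht]
    rw [this]
    exact (measurableSet_openCone (hc.inter_right isClosed_closedBall)).union
      (measurableSet_openCone hc).compl
  · have : rayNorm K ⁻¹' Iic t = ∅ :=
      eq_empty_of_forall_notMem fun x hx => ht ((rayNorm_nonneg hK x).trans hx)
    rw [this]
    exact MeasurableSet.empty

/-! ### Product structure of the Hausdorff measure on the cone -/

/-- The `d`-dimensional measure on the cone over `K`. -/
noncomputable def coneMeasure (d : ℕ) (K : Set E) : Measure E :=
  (Measure.hausdorffMeasure (d : ℝ)).restrict (openCone K)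

/-- The law of the distance to `K` along rays, for the measure on the unit part of the cone. -/
noncomputable def rayMeasure (d : ℕ) (K : Set E) : Measure ℝ :=
  ((coneMeasure d K).restrict {x | ‖x‖ ^ d < 1}).map (rayNorm K)

/-- For `s > 0`, the set on the left is the dilate by `c = s^(1/d)` of the one with `s = 1`, because
`rayNorm` is invariant under dilations; `H^d` scales by `c^d = s`. -/
theorem coneMeasure_rect {d : ℕ} (hd : 1 ≤ d) {K : Set E} (hc : IsCompact K)
    (hK : MeetsRaysOnce K) {G : Set ℝ} (hG : MeasurableSet G) (s : ℝ) :
    coneMeasure d K {x | rayNorm K x ∈ G ∧ ‖x‖ ^ d < s} =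
      rayMeasure d K G * (volume.restrict (Ioi (0 : ℝ))) (Iio s) := by
  have hg := measurable_rayNorm hc hK
  have hd0 : d ≠ 0 := by omega
  have hN : ∀ s : ℝ, MeasurableSet {x : E | ‖x‖ ^ d < s} := fun s =>
    measurableSet_lt (by fun_prop) measurable_const
  have hset : ∀ s : ℝ, MeasurableSet {x : E | rayNorm K x ∈ G ∧ ‖x‖ ^ d < s} := fun s =>
    (hg hG).inter (hN s)
  have hν : rayMeasure d K G =
      Measure.hausdorffMeasure (d : ℝ) ({x | rayNorm K x ∈ G ∧ ‖x‖ ^ d < 1} ∩ openCone K) := by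
    rw [rayMeasure, Measure.map_apply hg hG, Measure.restrict_apply (hg hG), coneMeasure,
      Measure.restrict_apply ((hg hG).inter (hN 1))]
    rfl
  rw [coneMeasure, Measure.restrict_apply (hset s), hν, Measure.restrict_apply measurableSet_Iio]
  by_cases hs : 0 < s
  · set c : ℝ := s ^ ((d : ℝ)⁻¹) with hcdef
    have hcpos : 0 < c := Real.rpow_pos_of_pos hs _
    have hcd : c ^ d = s := Real.rpow_inv_natCast_pow hs.le hd0
    have hscale : {x | rayNorm K x ∈ G ∧ ‖x‖ ^ d < s} ∩ openCone K =
        c • ({x | rayNorm K x ∈ G ∧ ‖x‖ ^ d < 1} ∩ openCone K) := by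
      ext x
      rw [mem_smul_set_iff_inv_smul_mem₀ hcpos.ne']
      have hci := inv_pos.2 hcpos
      simp only [mem_inter_iff, mem_ofPred_eq, smul_mem_openCone_iff K x hci,
        rayNorm_smul K x hci, norm_smul, mul_pow, Real.norm_eq_abs, abs_of_pos hci, inv_pow, hcd]
      rw [inv_mul_lt_iff₀ hs, mul_one]
    rw [hscale, Measure.hausdorffMeasure_smul₀ (Nat.cast_nonneg d) hcpos.ne', inter_comm (Iio s),
      Ioi_inter_Iio, Real.volume_Ioo, sub_zero, mul_comm, ENNReal.smul_def, smul_eq_mul]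
    congr 1
    rw [NNReal.rpow_natCast, ← hcd, ENNReal.ofReal, Real.toNNReal_pow hcpos.le]
    congr 2
    ext
    simp [abs_of_pos hcpos, hcpos.le]
  · have h1 : {x : E | rayNorm K x ∈ G ∧ ‖x‖ ^ d < s} = ∅ :=
      eq_empty_of_forall_notMem fun x hx => hs (lt_of_le_of_lt (by positivity) hx.2)
    have h2 : Iio s ∩ Ioi (0 : ℝ) = ∅ :=
      eq_empty_of_forall_notMem fun x hx => hs (lt_trans hx.2 hx.1)
    simp [h1, h2]

theorem rayMeasure_Iic_zero {d : ℕ} {K : Set E} (hc : IsCompact K) (hK : MeetsRaysOnce K) :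
    rayMeasure d K (Iic 0) = 0 := by
  have hg := measurable_rayNorm hc hK
  rw [rayMeasure, Measure.map_apply hg measurableSet_Iic]
  refine Measure.restrict_le_self.absolutelyContinuous ?_
  rw [coneMeasure, Measure.restrict_apply (hg measurableSet_Iic)]
  have : rayNorm K ⁻¹' Iic 0 ∩ openCone K = ∅ :=
    eq_empty_of_forall_notMem fun x hx => absurd (rayNorm_pos hK hx.2) (not_lt.2 hx.1)
  rw [this, measure_empty]

theorem rayMeasure_Ici_lt_top {d : ℕ} (hd : 1 ≤ d) {K : Set E} (hc : IsCompact K)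
    (hK : MeetsRaysOnce K)
    (hfin : ∀ c : ℝ, Measure.hausdorffMeasure (d : ℝ) (segmentCone K c) < ⊤)
    {a : ℝ} (ha : 0 < a) : rayMeasure d K (Ici a) < ⊤ := by
  have hg := measurable_rayNorm hc hK
  have hd0 : d ≠ 0 := by omega
  rw [rayMeasure, Measure.map_apply hg measurableSet_Ici, Measure.restrict_apply
    (hg measurableSet_Ici), coneMeasure, Measure.restrict_apply ((hg measurableSet_Ici).inter
    (measurableSet_lt (by fun_prop) measurable_const))]
  refine lt_of_le_of_lt (measure_mono ?_) (hfin a⁻¹)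
  rintro x ⟨⟨hx, hx1⟩, h0, l, hl, h⟩
  rw [mem_preimage, hK.rayNorm_eq h0 hl h, mem_Ici, norm_smul, Real.norm_eq_abs,
    abs_of_pos hl] at hx
  have hx1 : ‖x‖ < 1 := (pow_lt_one_iff_of_nonneg (norm_nonneg x) hd0).1 hx1
  -- From `a ≤ l * ‖x‖` and `‖x‖ < 1` one gets `a ≤ l`, so the factor `l⁻¹` stays below `a⁻¹`.
  refine ⟨l • x, h, l⁻¹, ⟨(inv_pos.2 hl).le, inv_anti₀ ha ?_⟩, (inv_smul_smul₀ hl.ne' x).symm⟩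
  nlinarith

theorem sigmaFinite_rayMeasure {d : ℕ} (hd : 1 ≤ d) {K : Set E} (hc : IsCompact K)
    (hK : MeetsRaysOnce K)
    (hfin : ∀ c : ℝ, Measure.hausdorffMeasure (d : ℝ) (segmentCone K c) < ⊤) :
    SigmaFinite (rayMeasure d K) := by
  -- The null set `Iic 0` is added only so that the pieces cover `ℝ`.
  refine ⟨⟨⟨fun k => Iic 0 ∪ Ici ((k : ℝ) + 1)⁻¹, fun _ => trivial, fun k => ?_, ?_⟩⟩⟩
  · refine lt_of_le_of_lt (measure_union_le _ _) ?_
    rw [rayMeasure_Iic_zero hc hK, zero_add]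
    exact rayMeasure_Ici_lt_top hd hc hK hfin (by positivity)
  · refine eq_univ_of_forall fun x => mem_iUnion.2 ?_
    rcases le_or_gt x 0 with h | h
    · exact ⟨0, Or.inl h⟩
    · obtain ⟨k, hk⟩ := exists_nat_ge x⁻¹
      exact ⟨k, Or.inr (inv_le_of_inv_le₀ h (by linarith))⟩

theorem map_coneMeasure_eq_prod {d : ℕ} (hd : 1 ≤ d) {K : Set E} (hc : IsCompact K)
    (hK : MeetsRaysOnce K)
    (hfin : ∀ c : ℝ, Measure.hausdorffMeasure (d : ℝ) (segmentCone K c) < ⊤) :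
    (coneMeasure d K).map (fun x => (rayNorm K x, ‖x‖ ^ d)) =
      (rayMeasure d K).prod (volume.restrict (Ioi 0)) := by
  have := sigmaFinite_rayMeasure hd hc hK hfin
  have hg := measurable_rayNorm hc hK
  symm
  refine Measure.prod_eq_generateFrom (C := {s | MeasurableSet s}) (D := range Iio)
    MeasurableSpace.generateFrom_measurableSet ?_ MeasurableSpace.isPiSystem_measurableSet
    isPiSystem_Iio (rayMeasure d K).toFiniteSpanningSetsIn ?_ ?_
  · exact (borel_eq_generateFrom_Iio ℝ).symm
  · refine ⟨fun k => Iio k, fun k => mem_range_self _, fun k => ?_, ?_⟩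
    · rw [Measure.restrict_apply measurableSet_Iio, inter_comm, Ioi_inter_Iio]
      exact measure_Ioo_lt_top
    · refine eq_univ_of_forall fun x => mem_iUnion.2 ?_
      exact exists_nat_gt x
  · rintro G hG _ ⟨s, rfl⟩
    rw [← coneMeasure_rect hd hc hK hG,
      Measure.map_apply (hg.prodMk (by fun_prop)) (MeasurableSet.prod hG measurableSet_Iio)]
    rfl

/-- Away from the origin, which is null since `d ≥ 1`, the set is `rayNorm ≤ t`, `‖x‖ ≤ rayNorm`;
its slice at `a ≤ t` is `(0, a^d]`. -/
theorem hausdorffMeasure_sharp {d : ℕ} (hd : 1 ≤ d) {K : Set E} (hc : IsCompact K)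
    (hK : MeetsRaysOnce K)
    (hfin : ∀ c : ℝ, Measure.hausdorffMeasure (d : ℝ) (segmentCone K c) < ⊤) (t : ℝ) :
    Measure.hausdorffMeasure (d : ℝ) (segmentCone (K ∩ closedBall 0 t) 1) =
      ∫⁻ a, (Iic t).indicator (fun a => ENNReal.ofReal (a ^ d)) a ∂(rayMeasure d K) := by
  have := sigmaFinite_rayMeasure hd hc hK hfin
  have hg := measurable_rayNorm hc hK
  have hd0 : d ≠ 0 := by omega
  have hms : MeasurableSet {p : ℝ × ℝ | p.1 ≤ t ∧ p.2 ≤ p.1 ^ d} :=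
    (measurableSet_le measurable_fst measurable_const).inter
      (measurableSet_le measurable_snd (measurable_fst.pow_const d))
  have : NullSingletonClass (Measure.hausdorffMeasure (d : ℝ) : Measure E) :=
    Measure.nullSingletonClass_hausdorff E (by positivity)
  have hset : segmentCone (K ∩ closedBall 0 t) 1 \ {0} =
      {x | rayNorm K x ≤ t ∧ ‖x‖ ^ d ≤ rayNorm K x ^ d} ∩ openCone K := by
    ext x
    rw [mem_inter_iff, mem_ofPred_eq,
      pow_le_pow_iff_left₀ (norm_nonneg x) (rayNorm_nonneg hK x) hd0]
    constructor
    · rintro ⟨⟨z, ⟨hz, hzt⟩, l, ⟨hl0, hl1⟩, rfl⟩, h0⟩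
      have hl : 0 < l := hl0.lt_of_ne (by rintro rfl; simp at h0)
      have hz' : l⁻¹ • l • z = z := inv_smul_smul₀ hl.ne' z
      have hzK : l⁻¹ • l • z ∈ K := by rwa [hz']
      rw [hK.rayNorm_eq h0 (inv_pos.2 hl) hzK, hz']
      refine ⟨⟨by simpa using hzt, ?_⟩, h0, l⁻¹, inv_pos.2 hl, hzK⟩
      rw [norm_smul, Real.norm_eq_abs, abs_of_pos hl]
      exact mul_le_of_le_one_left (norm_nonneg z) hl1
    · rintro ⟨⟨h1, h2⟩, h0, l, hl, h⟩
      rw [hK.rayNorm_eq h0 hl h] at h1 h2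
      refine ⟨⟨l • x, ⟨h, by simpa using h1⟩, l⁻¹, ⟨(inv_pos.2 hl).le, ?_⟩,
        (inv_smul_smul₀ hl.ne' x).symm⟩, h0⟩
      rw [norm_smul, Real.norm_eq_abs, abs_of_pos hl] at h2
      exact inv_le_one_of_one_le₀ ((le_mul_iff_one_le_left (norm_pos_iff.2 h0)).1 h2)
  rw [← measure_sdiff_null (measure_singleton (0 : E)), hset]
  calc _ = coneMeasure d K {x | rayNorm K x ≤ t ∧ ‖x‖ ^ d ≤ rayNorm K x ^ d} := by
        rw [coneMeasure, Measure.restrict_apply]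
        exact (measurableSet_le hg measurable_const).inter
          (measurableSet_le (by fun_prop) (hg.pow_const d))
    _ = (rayMeasure d K).prod (volume.restrict (Ioi 0))
        {p : ℝ × ℝ | p.1 ≤ t ∧ p.2 ≤ p.1 ^ d} := by
        rw [← map_coneMeasure_eq_prod hd hc hK hfin,
          Measure.map_apply (hg.prodMk (by fun_prop)) hms]
        rfl
    _ = _ := by
        rw [Measure.prod_apply hms]
        refine lintegral_congr fun a => ?_
        by_cases ha : a ≤ t
        · have : Prod.mk a ⁻¹' {p : ℝ × ℝ | p.1 ≤ t ∧ p.2 ≤ p.1 ^ d} = Iic (a ^ d) := by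
            ext b
            simp [ha]
          rw [this, indicator_of_mem (mem_Iic.2 ha), Measure.restrict_apply measurableSet_Iic,
            inter_comm, Ioi_inter_Iic, Real.volume_Ioc, sub_zero]
        · have : Prod.mk a ⁻¹' {p : ℝ × ℝ | p.1 ≤ t ∧ p.2 ≤ p.1 ^ d} = ∅ := by
            ext b
            simp [ha]
          rw [this, indicator_of_notMem (by simpa using ha), measure_empty]

/-- The slice at `a > 0` is `[a^d, r^d)`; truncation by `ENNReal.ofReal` accounts for `a > r`. -/
theorem coneMeasure_shade {d : ℕ} (hd : 1 ≤ d) {K : Set E} (hc : IsCompact K)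
    (hK : MeetsRaysOnce K)
    (hfin : ∀ c : ℝ, Measure.hausdorffMeasure (d : ℝ) (segmentCone K c) < ⊤) {r : ℝ}
    (hr : 0 ≤ r) :
    coneMeasure d K {x | rayNorm K x ≤ ‖x‖ ∧ ‖x‖ < r} =
      ∫⁻ a, ENNReal.ofReal (r ^ d - a ^ d) ∂(rayMeasure d K) := by
  have := sigmaFinite_rayMeasure hd hc hK hfin
  have hg := measurable_rayNorm hc hK
  have hd0 : d ≠ 0 := by omega
  have hms : MeasurableSet {p : ℝ × ℝ | p.1 ^ d ≤ p.2 ∧ p.2 < r ^ d} :=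
    (measurableSet_le (measurable_fst.pow_const d) measurable_snd).inter
      (measurableSet_lt measurable_snd measurable_const)
  have hpos : ∀ᵐ a ∂(rayMeasure d K), 0 < a := by
    have h := rayMeasure_Iic_zero (d := d) hc hK
    rw [ae_iff]
    simpa [Iic] using h
  calc _ = coneMeasure d K {x | rayNorm K x ^ d ≤ ‖x‖ ^ d ∧ ‖x‖ ^ d < r ^ d} := by
        congr 1
        ext x
        rw [mem_ofPred_eq, mem_ofPred_eq, pow_le_pow_iff_left₀ (rayNorm_nonneg hK x)
          (norm_nonneg x) hd0, pow_lt_pow_iff_left₀ (norm_nonneg x) hr hd0]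
    _ = (rayMeasure d K).prod (volume.restrict (Ioi 0))
        {p : ℝ × ℝ | p.1 ^ d ≤ p.2 ∧ p.2 < r ^ d} := by
        rw [← map_coneMeasure_eq_prod hd hc hK hfin,
          Measure.map_apply (hg.prodMk (by fun_prop)) hms]
        rfl
    _ = _ := by
        rw [Measure.prod_apply hms]
        refine lintegral_congr_ae ?_
        filter_upwards [hpos] with a ha
        have : Prod.mk a ⁻¹' {p : ℝ × ℝ | p.1 ^ d ≤ p.2 ∧ p.2 < r ^ d} = Ico (a ^ d) (r ^ d) := rfl
        rw [this, Measure.restrict_apply measurableSet_Ico, inter_eq_left.2, Real.volume_Ico]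
        exact fun b hb => lt_of_lt_of_le (pow_pos ha d) hb.1

end Rays

theorem lintegral_inv_pow {d : ℕ} (hd : 1 ≤ d) {a r : ℝ} (ha : 0 < a) (hr : 0 < r) :
    (d : ℝ≥0∞) * ENNReal.ofReal (r ^ d) *
      (ENNReal.ofReal (a ^ d) * ∫⁻ t in Ico a r, (ENNReal.ofReal (t ^ (d + 1)))⁻¹) =
      ENNReal.ofReal (r ^ d - a ^ d) := by
  rcases le_or_gt r a with h | h
  · rw [Ico_eq_empty_of_le h, ENNReal.ofReal_of_nonpos
      (sub_nonpos.2 (pow_le_pow_left₀ hr.le h d))]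
    simp
  have h0 : (0 : ℝ) ∉ uIcc a r := by
    rw [uIcc_of_le h.le]
    exact fun h => absurd h.1 (not_le.2 ha)
  have hcont : ContinuousOn (fun t : ℝ => t ^ (-((d : ℤ) + 1))) (uIcc a r) :=
    fun t ht => ((continuousAt_zpow₀ t _ (Or.inl (fun h => h0 (h ▸ ht)))).continuousWithinAt)
  have hint : ∫⁻ t in Ico a r, (ENNReal.ofReal (t ^ (d + 1)))⁻¹ =
      ENNReal.ofReal (((a ^ d)⁻¹ - (r ^ d)⁻¹) / d) := by
    have h1 : ∫ t in a..r, t ^ (-((d : ℤ) + 1)) = ((a ^ d)⁻¹ - (r ^ d)⁻¹) / d := by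
      rw [integral_zpow (Or.inr ⟨by omega, h0⟩)]
      have : -((d : ℤ) + 1) + 1 = -d := by ring
      rw [this, zpow_neg, zpow_neg, zpow_natCast, zpow_natCast]
      push_cast
      have hd' : (d : ℝ) ≠ 0 := by positivity
      rw [show -((d : ℝ) + 1) + 1 = -d by ring]
      field_simp
      ring
    rw [← h1, intervalIntegral.integral_of_le h.le, ofReal_integral_eq_lintegral_ofReal]
    · rw [restrict_Ico_eq_restrict_Ioc]
      refine setLIntegral_congr_fun measurableSet_Ioc fun t ht => ?_
      have ht0 : 0 < t := ha.trans ht.1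
      rw [← ENNReal.ofReal_inv_of_pos (by positivity), zpow_neg]
      norm_cast
    · exact (hcont.intervalIntegrable).1
    · filter_upwards [ae_restrict_mem measurableSet_Ioc] with t ht
      have ht0 : 0 < t := ha.trans ht.1
      positivity
  rw [hint, ← ENNReal.ofReal_natCast, ← ENNReal.ofReal_mul (by positivity),
    ← ENNReal.ofReal_mul (by positivity), ← ENNReal.ofReal_mul (by positivity)]
  congr 1
  have : (d : ℝ) ≠ 0 := by positivity
  field_simp

/-! ### Finiteness and compactness from the dyadic structure -/

/-- The parametrization of the affine space directed by the sides of a dyadic cube. -/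
noncomputable def DyadicCube.param {n : ℕ} (Q : DyadicCube n) (u : {i // i ∈ Q.dirs} → ℝ) :
    EuclideanSpace ℝ (Fin n) :=
  WithLp.toLp 2 fun i => if h : i ∈ Q.dirs then u ⟨i, h⟩ else (Q.corner i : ℝ) * (2 : ℝ) ^ (-Q.scale)

theorem DyadicCube.exists_lipschitzWith_param {n : ℕ} (Q : DyadicCube n) :
    ∃ C, LipschitzWith C Q.param := by
  refine ⟨_, (PiLp.lipschitzWith_toLp 2 (fun _ : Fin n => ℝ)).comp
    (LipschitzWith.of_dist_le_mul (K := 1) fun u v => ?_)⟩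
  rw [NNReal.coe_one, one_mul, dist_pi_le_iff dist_nonneg]
  intro i
  by_cases h : i ∈ Q.dirs
  · simpa [h] using dist_le_pi_dist u v ⟨i, h⟩
  · simp [h]

theorem DyadicCube.param_coord {n : ℕ} {Q : DyadicCube n} {x : EuclideanSpace ℝ (Fin n)}
    (hx : x ∈ Q.carrier) : Q.param (fun i => x i) = x := by
  ext i
  by_cases h : i ∈ Q.dirs
  · simp [DyadicCube.param, h]
  · simp [DyadicCube.param, h, (hx i).2 h]

theorem hausdorff_lt_top_of_isBounded {ι : Type*} [Fintype ι] {d : ℕ} (h : Fintype.card ι ≤ d)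
    {A : Set (ι → ℝ)} (hA : Bornology.IsBounded A) : Measure.hausdorffMeasure (d : ℝ) A < ⊤ := by
  refine lt_of_le_of_lt (Measure.hausdorffMeasure_mono (Nat.cast_le.2 h) A) ?_
  rw [hausdorffMeasure_pi_real]
  exact hA.measure_lt_top

theorem lipschitzOnWith_smul_comp {X E : Type*} [PseudoMetricSpace X] [NormedAddCommGroup E]
    [NormedSpace ℝ E] {A : Set X} {f : X → ℝ} {g : X → E} {Cf Cg c r : NNReal}
    (hf : LipschitzOnWith Cf f A) (hg : LipschitzOnWith Cg g A) (hfc : ∀ x ∈ A, ‖f x‖ ≤ c)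
    (hgr : ∀ x ∈ A, ‖g x‖ ≤ r) : LipschitzOnWith (c * Cg + Cf * r) (fun x => f x • g x) A := by
  refine LipschitzOnWith.of_dist_le_mul fun x hx y hy => ?_
  have h1 := hf.dist_le_mul x hx y hy
  have h2 := hg.dist_le_mul x hx y hy
  rw [dist_eq_norm] at h1 h2 ⊢
  have : f x • g x - f y • g y = f x • (g x - g y) + (f x - f y) • g y := by module
  rw [this]
  refine (norm_add_le _ _).trans ?_
  rw [norm_smul, norm_smul]
  calc _ ≤ c * (Cg * dist x y) + (Cf * dist x y) * r := by
        gcongr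
        exacts [hfc x hx, hgr y hy]
    _ = _ := by push_cast; ring

/-- Coning adds one parameter: the set is a Lipschitz image of a bounded set in `ℝ^(k+1)`, with `k =
Q.dim` and `k + 1 ≤ d`. The extra `none` coordinate is the factor along the segment. -/
theorem hausdorff_segmentCone_cube_lt_top {n d : ℕ}
    {φ : EuclideanSpace ℝ (Fin n) → EuclideanSpace ℝ (Fin n)} {C : NNReal}
    (hφ : LipschitzOnWith C φ (ball 0 1)) {Q : DyadicCube n} (hQ : Q.dim < d) (r c : ℝ) :
    hausdorff n d (segmentCone (φ '' (Q.carrier ∩ ball 0 1) ∩ closedBall 0 r) c) < ⊤ := by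
  classical
  obtain ⟨CP, hP⟩ := Q.exists_lipschitzWith_param
  let π : (Option {i // i ∈ Q.dirs} → ℝ) → ({i // i ∈ Q.dirs} → ℝ) := fun w i => w (some i)
  have hπ : LipschitzWith 1 π := LipschitzWith.of_dist_le_mul fun u v => by
    rw [NNReal.coe_one, one_mul, dist_pi_le_iff dist_nonneg]
    exact fun i => dist_le_pi_dist u v (some i)
  have hnone : LipschitzWith 1 fun w : Option {i // i ∈ Q.dirs} → ℝ => w none :=
    LipschitzWith.of_dist_le_mul fun u v => by
      rw [NNReal.coe_one, one_mul]
      exact dist_le_pi_dist u v none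
  -- The product with the scalar is Lipschitz only where both factors are bounded, and `φ` only on
  -- the unit ball; `A` records these constraints.
  let A : Set (Option {i // i ∈ Q.dirs} → ℝ) :=
    {w | w none ∈ Icc 0 c ∧ ‖π w‖ ≤ 1 ∧ Q.param (π w) ∈ ball 0 1 ∧
      φ (Q.param (π w)) ∈ closedBall 0 r}
  have hA : Bornology.IsBounded A := by
    refine isBounded_closedBall (x := 0) (r := max c 1) |>.subset fun w hw => ?_
    rw [mem_closedBall_zero_iff, pi_norm_le_iff_of_nonneg (le_max_of_le_right zero_le_one)]
    rintro (_ | i)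
    · rw [Real.norm_eq_abs, abs_of_nonneg hw.1.1]
      exact hw.1.2.trans (le_max_left _ _)
    · exact ((norm_le_pi_norm (π w) i).trans hw.2.1).trans (le_max_right _ _)
  have hLip : LipschitzOnWith _ (fun w => w none • φ (Q.param (π w))) A :=
    lipschitzOnWith_smul_comp (c := c.toNNReal) (r := r.toNNReal) (hnone.lipschitzOnWith)
      (hφ.comp (hP.comp hπ).lipschitzOnWith fun w hw => hw.2.2.1)
      (fun w hw => by
        rw [Real.norm_eq_abs, abs_of_nonneg hw.1.1]
        exact hw.1.2.trans (Real.le_coe_toNNReal c))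
      (fun w hw => (mem_closedBall_zero_iff.1 hw.2.2.2).trans (Real.le_coe_toNNReal r))
  have hcard : Fintype.card (Option {i // i ∈ Q.dirs}) ≤ d := by
    rw [Fintype.card_option, Fintype.card_coe]
    exact hQ
  have hsub : segmentCone (φ '' (Q.carrier ∩ ball 0 1) ∩ closedBall 0 r) c ⊆
      (fun w => w none • φ (Q.param (π w))) '' A := by
    rintro _ ⟨_, ⟨⟨p, ⟨hpQ, hp⟩, rfl⟩, hr⟩, l, hl, rfl⟩
    have hpar : Q.param (fun i => p i) = p := DyadicCube.param_coord hpQ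
    refine ⟨fun o => o.elim l fun i => p i, ⟨hl, ?_, ?_, ?_⟩, ?_⟩
    · rw [pi_norm_le_iff_of_nonneg zero_le_one]
      intro i
      exact (PiLp.norm_apply_le p i).trans (mem_ball_zero_iff.1 hp).le
    · exact hpar.symm ▸ hp
    · exact (congrArg φ hpar).symm ▸ hr
    · exact congrArg (fun q => l • φ q) hpar
  refine lt_of_le_of_lt (measure_mono hsub) (lt_of_le_of_lt
    (hLip.hausdorffMeasure_image_le (Nat.cast_nonneg d)) ?_)
  exact ENNReal.mul_lt_top (ENNReal.rpow_lt_top_of_nonneg (Nat.cast_nonneg d) ENNReal.coe_ne_top)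
    (hausdorff_lt_top_of_isBounded hcard hA)

theorem DyadicCube.isClosed_carrier {n : ℕ} (Q : DyadicCube n) : IsClosed Q.carrier := by
  have : Q.carrier = ⋂ i, ({x | i ∈ Q.dirs → x i ∈ Icc ((Q.corner i : ℝ) * (2 : ℝ) ^ (-Q.scale))
      (((Q.corner i : ℝ) + 1) * (2 : ℝ) ^ (-Q.scale))} ∩
      {x | i ∉ Q.dirs → x i = (Q.corner i : ℝ) * (2 : ℝ) ^ (-Q.scale)}) := by
    ext x
    simp only [mem_iInter]
    rfl
  rw [this]
  have hc : ∀ i, Continuous fun x : EuclideanSpace ℝ (Fin n) => x i := fun i => by fun_prop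
  refine isClosed_iInter fun i => ?_
  by_cases h : i ∈ Q.dirs
  · simpa [h] using! isClosed_Icc.preimage (hc i)
  · simpa [h] using! isClosed_singleton.preimage (hc i)

theorem IsBilipschitzOnto.injOn {n : ℕ} {ψ : EuclideanSpace ℝ (Fin n) → EuclideanSpace ℝ (Fin n)}
    {A B : Set (EuclideanSpace ℝ (Fin n))} (h : IsBilipschitzOnto ψ A B) : InjOn ψ A := by
  obtain ⟨⟨C, hC, h⟩, -⟩ := h
  intro x hx y hy hxy
  have h1 := (h x hx y hy).1
  rw [hxy, dist_self] at h1
  have hC' : 0 < C⁻¹ := inv_pos.2 (by linarith)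
  exact dist_le_zero.1 (by nlinarith [dist_nonneg (x := x) (y := y)])

theorem IsBilipschitzOnto.continuousOn {n : ℕ}
    {ψ : EuclideanSpace ℝ (Fin n) → EuclideanSpace ℝ (Fin n)}
    {A B : Set (EuclideanSpace ℝ (Fin n))} (h : IsBilipschitzOnto ψ A B) : ContinuousOn ψ A := by
  obtain ⟨⟨C, hC, h⟩, -⟩ := h
  exact (LipschitzOnWith.of_dist_le_mul (K := ⟨C, by linarith⟩)
    fun x hx y hy => (h x hx y hy).2).continuousOn

theorem IsBilipschitzOnto.exists_lipschitz_leftInverse {n : ℕ}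
    {ψ : EuclideanSpace ℝ (Fin n) → EuclideanSpace ℝ (Fin n)}
    {A B : Set (EuclideanSpace ℝ (Fin n))} (h : IsBilipschitzOnto ψ A B) :
    ∃ C φ, LipschitzOnWith C φ B ∧ ∀ x ∈ A, φ (ψ x) = x := by
  have hinv := h.injOn.leftInvOn_invFunOn
  obtain ⟨⟨C, hC, h⟩, rfl⟩ := h
  refine ⟨⟨C, by linarith⟩, Function.invFunOn ψ A, LipschitzOnWith.of_dist_le_mul ?_,
    fun x hx => hinv hx⟩
  rintro _ ⟨x, hx, rfl⟩ _ ⟨y, hy, rfl⟩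
  rw [hinv hx, hinv hy]
  have h1 := (h x hx y hy).1
  rwa [inv_mul_le_iff₀ (by linarith)] at h1

/-- Inside the closed ball, each `L j` is the preimage of a closed union of cubes under a continuous
map; injectivity of `ψ` on `s • U` gives the converse inclusion. -/
theorem LipschitzAssumption.isCompact_inter {n jmax d : ℕ} {U : Set (EuclideanSpace ℝ (Fin n))}
    {L : Fin (jmax + 1) → Set (EuclideanSpace ℝ (Fin n))} (hL : LipschitzAssumption d U L)
    {r : ℝ} (hr : closedBall 0 r ⊆ U) : IsCompact (boundaryUnion L ∩ closedBall 0 r) := by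
  obtain ⟨-, hLU, s, hs, ψ, hψ, hcube⟩ := hL
  rw [boundaryUnion, iUnion₂_inter]
  refine (Set.toFinite _).isCompact_biUnion fun j _ => ?_
  obtain ⟨𝒬, h𝒬, -, heq⟩ := hcube j
  have hclosed : IsClosed (⋃ Q ∈ 𝒬, Q.carrier) :=
    h𝒬.isClosed_biUnion fun Q _ => Q.isClosed_carrier
  have hcont : ContinuousOn (fun x => ψ (s • x)) (closedBall 0 r) :=
    hψ.continuousOn.comp (by fun_prop) fun x hx => smul_mem_smul_set (hr hx)
  have hset : L j ∩ closedBall 0 r =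
      closedBall 0 r ∩ (fun x => ψ (s • x)) ⁻¹' (⋃ Q ∈ 𝒬, Q.carrier) := by
    ext x
    constructor
    · rintro ⟨hx, hxr⟩
      have : ψ (s • x) ∈ ψ '' (s • L j) := mem_image_of_mem _ (smul_mem_smul_set hx)
      rw [heq] at this
      exact ⟨hxr, this.2⟩
    · rintro ⟨hxr, hx⟩
      have hsx : s • x ∈ s • U := smul_mem_smul_set (hr hxr)
      have : ψ (s • x) ∈ ψ '' (s • L j) := by
        rw [heq, ← hψ.2]
        exact ⟨mem_image_of_mem _ hsx, hx⟩
      obtain ⟨y, hy, hyx⟩ := this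
      have hyU : y ∈ s • U := smul_set_mono (hLU j) hy
      rw [hψ.injOn hyU hsx hyx, smul_mem_smul_set_iff₀ hs.ne'] at hy
      exact ⟨hy, hxr⟩
  rw [hset]
  exact (isCompact_closedBall 0 r).of_isClosed_subset
    (hcont.preimage_isClosed_of_isClosed isClosed_closedBall hclosed) inter_subset_left

theorem LipschitzAssumption.hausdorff_segmentCone_lt_top {n jmax d : ℕ}
    {U : Set (EuclideanSpace ℝ (Fin n))} {L : Fin (jmax + 1) → Set (EuclideanSpace ℝ (Fin n))}
    (hL : LipschitzAssumption d U L) (r c : ℝ) :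
    hausdorff n d (segmentCone (boundaryUnion L ∩ closedBall 0 r) c) < ⊤ := by
  obtain ⟨-, hLU, s, hs, ψ, hψ, hcube⟩ := hL
  choose 𝒬 h𝒬 hdim heq using hcube
  obtain ⟨C, φ, hφ, hinv⟩ := hψ.exists_lipschitz_leftInverse
  have hφs : LipschitzOnWith _ (fun p => s⁻¹ • φ p) (ball 0 1) :=
    (lipschitzWith_smul s⁻¹).comp_lipschitzOnWith hφ
  have hsub : segmentCone (boundaryUnion L ∩ closedBall 0 r) c ⊆
      ⋃ j ∈ {j : Fin (jmax + 1) | j ≠ 0}, ⋃ Q ∈ 𝒬 j,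
        segmentCone ((fun p => s⁻¹ • φ p) '' (Q.carrier ∩ ball 0 1) ∩ closedBall 0 r) c := by
    rintro _ ⟨z, ⟨hz, hzr⟩, l, hl, rfl⟩
    obtain ⟨j, hj, hzj⟩ := mem_iUnion₂.1 hz
    have hmem : ψ (s • z) ∈ ψ '' (s • L j) := mem_image_of_mem _ (smul_mem_smul_set hzj)
    rw [heq] at hmem
    obtain ⟨Q, hQ, hzQ⟩ := mem_iUnion₂.1 hmem.2
    refine mem_iUnion₂.2 ⟨j, hj, mem_iUnion₂.2 ⟨Q, hQ, z, ⟨⟨ψ (s • z), ⟨hzQ, hmem.1⟩, ?_⟩, hzr⟩,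
      l, hl, rfl⟩⟩
    simp only [hinv _ (smul_mem_smul_set (hLU j hzj)), inv_smul_smul₀ hs.ne']
  refine lt_of_le_of_lt (measure_mono hsub) ?_
  exact measure_biUnion_lt_top (Set.toFinite _) fun j hj => measure_biUnion_lt_top (h𝒬 j)
    fun Q hQ => hausdorff_segmentCone_cube_lt_top hφs (hdim j hj Q hQ) r c

/-! ### Comparison of the correction term with the shade -/

theorem correction_eq_hausdorff_shade {n d : ℕ} (hd : 1 ≤ d)
    {L' : Set (EuclideanSpace ℝ (Fin n))} {r : ℝ} (hr : 0 < r)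
    (hc : IsCompact (L' ∩ closedBall 0 r)) (hK : MeetsRaysOnce (L' ∩ closedBall 0 r))
    (hfin : ∀ c, hausdorff n d (segmentCone (L' ∩ closedBall 0 r) c) < ⊤) :
    correction d L' r = hausdorff n d (shade L' ∩ ball 0 r) := by
  set K := L' ∩ closedBall 0 r with hKdef
  have := sigmaFinite_rayMeasure hd hc hK hfin
  have hg := measurable_rayNorm hc hK
  have hpos : ∀ᵐ a ∂(rayMeasure d K), 0 < a := by
    have h := rayMeasure_Iic_zero (d := d) hc hK
    rw [ae_iff]
    simpa [Iic] using h
  have hsharp : ∀ t ∈ Ioo 0 r, sharpMeasure d L' t =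
      ∫⁻ a, (Iic t).indicator (fun a => ENNReal.ofReal (a ^ d)) a ∂(rayMeasure d K) := by
    intro t ht
    rw [← hausdorffMeasure_sharp hd hc hK hfin t, hKdef, inter_assoc,
      inter_eq_right.2 (closedBall_subset_closedBall ht.2.le)]
    rfl
  have hshade : hausdorff n d (shade L' ∩ ball 0 r) =
      coneMeasure d K {x | rayNorm K x ≤ ‖x‖ ∧ ‖x‖ < r} := by
    have : NullSingletonClass (hausdorff n d) :=
      Measure.nullSingletonClass_hausdorff _ (by positivity)
    have hm : MeasurableSet {x | rayNorm K x ≤ ‖x‖ ∧ ‖x‖ < r} :=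
      (measurableSet_le hg measurable_norm).inter (measurableSet_lt measurable_norm measurable_const)
    rw [coneMeasure, Measure.restrict_apply hm,
      ← measure_sdiff_null (measure_singleton (0 : EuclideanSpace ℝ (Fin n)))]
    congr 1
    ext x
    constructor
    · rintro ⟨⟨⟨l, ⟨hl, hl1⟩, hx⟩, hxr⟩, h0⟩
      have hn : ‖l • x‖ ≤ ‖x‖ := by
        rw [norm_smul, Real.norm_eq_abs, abs_of_pos hl]
        exact mul_le_of_le_one_left (norm_nonneg x) hl1
      have hxr' : ‖x‖ < r := mem_ball_zero_iff.1 hxr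
      -- Since `l ≤ 1`, the shading point is no farther than `x`, so `K` already casts the whole
      -- shade in `ball 0 r`.
      have hxK : l • x ∈ K := ⟨hx, mem_closedBall_zero_iff.2 (hn.trans hxr'.le)⟩
      refine ⟨⟨?_, hxr'⟩, h0, l, hl, hxK⟩
      rwa [hK.rayNorm_eq h0 hl hxK]
    · rintro ⟨⟨h1, h2⟩, h0, l, hl, hx⟩
      rw [hK.rayNorm_eq h0 hl hx, norm_smul, Real.norm_eq_abs, abs_of_pos hl] at h1
      exact ⟨⟨⟨l, ⟨hl, (mul_le_iff_le_one_left (norm_pos_iff.2 h0)).1 h1⟩, hx.1⟩,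
        mem_ball_zero_iff.2 h2⟩, h0⟩
  rw [hshade, coneMeasure_shade hd hc hK hfin hr.le, correction]
  have hmeas : Measurable fun p : ℝ × ℝ =>
      (Iic p.1).indicator (fun a => ENNReal.ofReal (a ^ d)) p.2 *
        (ENNReal.ofReal (p.1 ^ (d + 1)))⁻¹ := by
    have h1 : Measurable fun p : ℝ × ℝ =>
        {p : ℝ × ℝ | p.2 ≤ p.1}.indicator (fun p => ENNReal.ofReal (p.2 ^ d)) p :=
      Measurable.indicator (by fun_prop) (measurableSet_le measurable_snd measurable_fst)
    exact Measurable.mul h1 (by fun_prop)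
  have hswap : ∫⁻ t in Ioo 0 r, sharpMeasure d L' t / ENNReal.ofReal (t ^ (d + 1)) =
      ∫⁻ a, (∫⁻ t in Ioo 0 r, (Iic t).indicator (fun a => ENNReal.ofReal (a ^ d)) a *
        (ENNReal.ofReal (t ^ (d + 1)))⁻¹) ∂(rayMeasure d K) := by
    rw [← lintegral_lintegral_swap hmeas.aemeasurable]
    refine setLIntegral_congr_fun measurableSet_Ioo fun t ht => ?_
    simp only
    rw [hsharp t ht, div_eq_mul_inv, lintegral_mul_const]
    exact Measurable.indicator (by fun_prop) measurableSet_Iic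
  rw [hswap, ← lintegral_const_mul' _ _
    (ENNReal.mul_ne_top (ENNReal.natCast_ne_top d) ENNReal.ofReal_ne_top)]
  refine lintegral_congr_ae ?_
  filter_upwards [hpos] with a ha
  rw [← lintegral_inv_pow hd ha hr, ← lintegral_const_mul' _ _ ENNReal.ofReal_ne_top]
  congr 1
  rw [← lintegral_indicator measurableSet_Ioo, ← lintegral_indicator measurableSet_Ico]
  refine lintegral_congr fun t => ?_
  -- The indicator `a ≤ t`, seen as a function of `t`, turns `Ioo 0 r` into `Ico a r` because `a >
  -- 0`.
  have hI : t ∈ Ico a r ↔ t ∈ Ioo 0 r ∧ a ≤ t :=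
    ⟨fun h => ⟨⟨ha.trans_le h.1, h.2⟩, h.1⟩, fun h => ⟨h.2, h.1.2⟩⟩
  by_cases hat : a ≤ t <;> by_cases ht : t ∈ Ioo 0 r <;> simp only [indicator, hI, hat, ht, mem_Iic,
    and_true, and_false, if_true, if_false, zero_mul]

theorem meetsRaysOnce_of_subsingleton {n : ℕ} {L' : Set (EuclideanSpace ℝ (Fin n))} {r R : ℝ}
    (hrR : r < R) (h : ∀ x, (L' ∩ ball 0 R ∩ radius x).Subsingleton) :
    MeetsRaysOnce (L' ∩ closedBall 0 r) := by
  intro x hx l l' hl hl' hlx hlx'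
  -- Both points lie on the single radius ending at the farther one, to which the hypothesis
  -- applies.
  have key : ∀ k, 0 < k → k ≤ max l l' → k • x ∈ radius (max l l' • x) := fun k hk hkm => by
    have hm : 0 < max l l' := lt_max_of_lt_left hl
    exact ⟨k / max l l', ⟨div_pos hk hm, (div_le_one hm).2 hkm⟩,
      by rw [smul_smul, div_mul_cancel₀ _ hm.ne']⟩
  have hb := closedBall_subset_ball (x := (0 : EuclideanSpace ℝ (Fin n))) hrR
  have := h (max l l' • x) ⟨⟨hlx.1, hb hlx.2⟩, key l hl (le_max_left _ _)⟩
    ⟨⟨hlx'.1, hb hlx'.2⟩, key l' hl' (le_max_right _ _)⟩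
  exact smul_left_injective ℝ hx this

end SlidingMonotonicity

theorem mainTheorem2 (n d jmax : ℕ) (hd : 1 ≤ d)
    (U : Set (EuclideanSpace ℝ (Fin n))) (hU : IsOpen U)
    (hU0 : (0 : EuclideanSpace ℝ (Fin n)) ∈ U)
    (L : Fin (jmax + 1) → Set (EuclideanSpace ℝ (Fin n)))
    (hL : SlidingMonotonicity.LipschitzAssumption d U L)
    (hcone : ∃ ρ : ℝ, 0 < ρ ∧ Metric.closedBall 0 ρ ⊆ U ∧
      SlidingMonotonicity.hausdorff n d
        (SlidingMonotonicity.truncatedCone (SlidingMonotonicity.boundaryUnion L) ρ) < ⊤)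
    (R₁ : ℝ) (hR₁ : Metric.ball 0 R₁ ⊆ U)
    (R : ℝ) (hR : R ∈ Set.Ioo 0 R₁)
    (honce : ∀ x : EuclideanSpace ℝ (Fin n),
      (SlidingMonotonicity.boundaryUnion L ∩ Metric.ball 0 R ∩
        SlidingMonotonicity.radius x).Subsingleton) :
    ∀ r ∈ Set.Ioo 0 R,
      SlidingMonotonicity.correction d (SlidingMonotonicity.boundaryUnion L) r =
        SlidingMonotonicity.hausdorff n d
          (SlidingMonotonicity.shade (SlidingMonotonicity.boundaryUnion L) ∩ Metric.ball 0 r) ∧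
      ∀ E : Set (EuclideanSpace ℝ (Fin n)),
        SlidingMonotonicity.generalFunctional d (SlidingMonotonicity.boundaryUnion L) E r =
          SlidingMonotonicity.shadeFunctional d (SlidingMonotonicity.boundaryUnion L) E r := by

  intro r hr
  have hrR₁ : Metric.closedBall 0 r ⊆ U :=
    (Metric.closedBall_subset_ball (hr.2.trans hR.2)).trans hR₁
  have h := SlidingMonotonicity.correction_eq_hausdorff_shade hd hr.1 (hL.isCompact_inter hrR₁)
    (SlidingMonotonicity.meetsRaysOnce_of_subsingleton hr.2 honce)
    (hL.hausdorff_segmentCone_lt_top r)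
  refine ⟨h, fun E => ?_⟩
  rw [SlidingMonotonicity.generalFunctional, SlidingMonotonicity.shadeFunctional, h]
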